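/- Let $a\ge 3$ be an integer, written $a=3A+a_0$ with $A\in\mathbb N_0$ and $a_0\in\{0,1,2\}$, let $\rho$ be a root of $x^3+(a-1)x^2-ax-1$, and let $K=\mathbb Q(\rho)$ (a totally real cubic field). An element of $K$ is totally positive if all its images under the embeddings $K\to\mathbb R$ are positive. An element $\alpha\in\mathbb Z[\rho]$ is indecomposable in $\mathbb Z[\rho]$ if it is totally positive and is not a sum $\alpha=\beta+\gamma$ of two totally positive elements $\beta,\gamma\in\mathbb Z[\rho]$. Put \[ B=\begin{cases} 3a^2-3a+1 & \text{if } a\le 4,\\ 4A^3+18A^2+26A+13 & \text{if } a\ge 5 \text{ and } a_0=2,\\ 4A^3+14A^2+16A+7 & \text{if } a\ge 5 \text{ and } a_0=1,\\ 4A^3+10A^2+8A+3 & \text{if } a\ge 5 \text{ and } a_0=0. \end{cases} \] Then every $\alpha$ that is indecomposable in $\mathbb Z[\rho]$ satisfies $N_{K/\mathbb Q}(\alpha)\le B$. Moreover the bound is attained: there is an $\alpha$ indecomposable in $\mathbb Z[\rho]$ with $N_{K/\mathbb Q}(\alpha)=B$. -/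

import Mathlib

/-- An element `α` of a number field `K` is totally positive if `σ α > 0` for every embedding
`σ` of `K` into `ℝ`. -/
def IsTotallyPositive {K : Type*} [Field K] (α : K) : Prop :=
  ∀ σ : K →+* ℝ, 0 < σ α

/-- `α` is indecomposable in the order `O`: it is a totally positive element of `O` which is not
a sum of two totally positive elements of `O`. -/
def IsIndecomposableIn {K : Type*} [Field K] (O : Subalgebra ℤ K) (α : K) : Prop :=
  (α ∈ O ∧ IsTotallyPositive α) ∧
    ¬ ∃ β γ : K, (β ∈ O ∧ IsTotallyPositive β) ∧ (γ ∈ O ∧ IsTotallyPositive γ) ∧ α = β + γ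

/-- The norm bound for `ℤ[ρ]`, where `a = 3 * A + a₀` with `a₀ ∈ {0, 1, 2}`. -/
def ennolaNormBound (a A a₀ : ℕ) : ℚ :=
  if a ≤ 4 then 3 * (a : ℚ) ^ 2 - 3 * (a : ℚ) + 1
  else if a₀ = 2 then 4 * (A : ℚ) ^ 3 + 18 * (A : ℚ) ^ 2 + 26 * (A : ℚ) + 13
  else if a₀ = 1 then 4 * (A : ℚ) ^ 3 + 14 * (A : ℚ) ^ 2 + 16 * (A : ℚ) + 7
  else 4 * (A : ℚ) ^ 3 + 10 * (A : ℚ) ^ 2 + 8 * (A : ℚ) + 3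

/-!
The cubic is `x (x - 1) (x + a) - 1`, so `ρ`, `ρ - 1` and `ρ + a` are units of `ℤ[ρ]`, and
`ρ + a`, `ρ (ρ - 1)`, `ρ / (ρ - 1) = ρ² + a ρ + 1` are totally positive. Consider the two simplicial
cones spanned by the units `1, ρ², ρ² - ρ` and `1, ρ², ρ² + a ρ + 1`. The
functionals `a (x + z)` and `a (x + z) - y` of `x + y ρ + z ρ²` take the value `a` on the generators
of the first and of the second cone; they are positive combinations of the real embeddings
(`functionals_pos`), hence take positive integer values on totally positive elements of `ℤ[ρ]`.

The unit translates of the two cones cover the totally positive elements. This follows by descent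
(`exists_unit_mul_mem_cone`): if one of the three coordinates of an element with respect to the
generators of a cone is negative, the functional belonging to the cone on the other side of that
face has a smaller value, and the values are positive integers.

The first cone is unimodular, so its only indecomposable candidates are units. The second has index
`a`, and reducing modulo its generators leaves the units and `1 + (a - m) ρ + ρ²` with `0 < m < a`,
of norm `(a + 2 - m) m (m + 1) + 1` (`norm_of_indecomposable`). All of the latter are indecomposable:
by the covering, `a (x + z) - y` is at least `a` on every totally positive element
(`le_functional`), while it equals `a + m < 2 a` on these (`indecomposable_interior`). The bound is
therefore the maximum of the cubic polynomial in `m` over `0 < m < a`, attained at `m = a - 1` for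
`a ≤ 4` and near `m = 2 a / 3` otherwise (`norm_form_le`, `exists_maximiser`).
-/

namespace EnnolaCubic

open Polynomial

variable {K : Type*} [Field K]

/-! ### The order and its coordinates -/

/-- The element `x + y ρ + z ρ²`. -/
def elem (ρ : K) (x y z : ℤ) : K := x + y * ρ + z * ρ ^ 2

theorem elem_add (ρ : K) (x y z x' y' z' : ℤ) :
    elem ρ x y z + elem ρ x' y' z' = elem ρ (x + x') (y + y') (z + z') := by
  simp only [elem]; push_cast; ring

theorem elem_mul {a : ℤ} {ρ : K} (hρ : ρ ^ 3 + ((a : K) - 1) * ρ ^ 2 - a * ρ - 1 = 0)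
    (p q r x y z : ℤ) :
    elem ρ p q r * elem ρ x y z =
      elem ρ (p * x + q * z + r * (y - (a - 1) * z))
        (p * y + q * (x + a * z) + r * (z + a * (y - (a - 1) * z)))
        (p * z + q * (y - (a - 1) * z) +
          r * (x + a * z - (a - 1) * (y - (a - 1) * z))) := by
  simp only [elem]; push_cast
  linear_combination ((q : K) * z + r * y + r * z * ρ - r * z * ((a : K) - 1)) * hρ

theorem elem_mem (ρ : K) (x y z : ℤ) : elem ρ x y z ∈ Algebra.adjoin ℤ {ρ} := by
  have h := Algebra.self_mem_adjoin_singleton ℤ ρ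
  have hc : ∀ n : ℤ, (n : K) ∈ Algebra.adjoin ℤ {ρ} := fun n => intCast_mem _ n
  exact add_mem (add_mem (hc x) (mul_mem (hc y) h)) (mul_mem (hc z) (pow_mem h 2))

theorem exists_elem_of_mem {a : ℤ} {ρ : K}
    (hρ : ρ ^ 3 + ((a : K) - 1) * ρ ^ 2 - a * ρ - 1 = 0) {α : K}
    (hα : α ∈ Algebra.adjoin ℤ {ρ}) : ∃ x y z : ℤ, α = elem ρ x y z := by
  induction hα using Algebra.adjoin_induction with
  | mem β hβ =>
    rw [Set.mem_singleton_iff] at hβ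
    exact ⟨0, 1, 0, by simp [elem, hβ]⟩
  | algebraMap n => exact ⟨n, 0, 0, by simp [elem]⟩
  | add β γ _ _ hβ hγ =>
    obtain ⟨x, y, z, rfl⟩ := hβ
    obtain ⟨x', y', z', rfl⟩ := hγ
    exact ⟨_, _, _, elem_add ρ x y z x' y' z'⟩
  | mul β γ _ _ hβ hγ =>
    obtain ⟨x, y, z, rfl⟩ := hβ
    obtain ⟨x', y', z', rfl⟩ := hγ
    exact ⟨_, _, _, elem_mul hρ x y z x' y' z'⟩

theorem map_elem (σ : K →+* ℝ) (ρ : K) (x y z : ℤ) :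
    σ (elem ρ x y z) = x + y * σ ρ + z * σ ρ ^ 2 := by
  simp [elem]

/-! ### The power basis, the norm form and the real embeddings -/

theorem irreducible_cubic {a : ℤ} (ha : 3 ≤ a) :
    Irreducible (X ^ 3 + C (a - 1) * X ^ 2 - C a * X - 1 : ℤ[X]) := by
  have hd : (X ^ 3 + C (a - 1) * X ^ 2 - C a * X - 1 : ℤ[X]).natDegree = 3 := by
    compute_degree!
  have hm : (X ^ 3 + C (a - 1) * X ^ 2 - C a * X - 1 : ℤ[X]).Monic := by monicity!
  rw [hm.irreducible_iff_roots_eq_zero_of_degree_le_three (by omega) (by omega)]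
  refine Multiset.eq_zero_of_forall_notMem fun n hn => ?_
  have h := (mem_roots'.1 hn).2
  simp only [IsRoot.def, eval_sub, eval_add, eval_mul, eval_pow, eval_X, eval_C, eval_one] at h
  have h1 : n * ((n - 1) * (n + a)) = 1 := by linear_combination h
  rcases Int.eq_one_or_neg_one_of_mul_eq_one h1 with rfl | rfl
  · omega
  · ring_nf at h1; omega

theorem minpoly_eq [CharZero K] {a : ℤ} (ha : 3 ≤ a) {ρ : K}
    (hρ : ρ ^ 3 + ((a : K) - 1) * ρ ^ 2 - a * ρ - 1 = 0) :
    minpoly ℚ ρ = (X ^ 3 + C ((a : ℚ) - 1) * X ^ 2 - C (a : ℚ) * X - 1 : ℚ[X]) := by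
  have hm : (X ^ 3 + C (a - 1) * X ^ 2 - C a * X - 1 : ℤ[X]).Monic := by monicity!
  have hmap : (X ^ 3 + C (a - 1) * X ^ 2 - C a * X - 1 : ℤ[X]).map (algebraMap ℤ ℚ) =
      (X ^ 3 + C ((a : ℚ) - 1) * X ^ 2 - C (a : ℚ) * X - 1 : ℚ[X]) := by
    simp [Polynomial.map_sub, Polynomial.map_add]
  have hirr := (hm.irreducible_iff_irreducible_map_fraction_map (K := ℚ)).1 (irreducible_cubic ha)
  rw [hmap] at hirr
  refine (minpoly.eq_of_irreducible_of_monic hirr ?_ ?_).symm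
  · simpa using hρ
  · rw [← hmap]; exact hm.map _

theorem exists_powerBasis [NumberField K] {a : ℤ} (ha : 3 ≤ a) {ρ : K}
    (hρ : ρ ^ 3 + ((a : K) - 1) * ρ ^ 2 - a * ρ - 1 = 0)
    (hK : IntermediateField.adjoin ℚ {ρ} = ⊤) :
    ∃ pb : PowerBasis ℚ K, pb.gen = ρ ∧ pb.dim = 3 := by
  have hint : IsIntegral ℚ ρ := Algebra.IsIntegral.isIntegral ρ
  let pb : PowerBasis ℚ K := (IntermediateField.adjoin.powerBasis hint).map
    ((IntermediateField.equivOfEq hK).trans IntermediateField.topEquiv)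
  have hgen : pb.gen = ρ := by
    simp [pb, IntermediateField.adjoin.powerBasis_gen]
  refine ⟨pb, hgen, ?_⟩
  rw [← pb.natDegree_minpoly, hgen, minpoly_eq ha hρ]
  compute_degree!

theorem exists_basis [NumberField K] {a : ℤ} (ha : 3 ≤ a) {ρ : K}
    (hρ : ρ ^ 3 + ((a : K) - 1) * ρ ^ 2 - a * ρ - 1 = 0)
    (hK : IntermediateField.adjoin ℚ {ρ} = ⊤) :
    ∃ b : Module.Basis (Fin 3) ℚ K, ∀ i, b i = ρ ^ (i : ℕ) := by
  obtain ⟨pb, hgen, hdim⟩ := exists_powerBasis ha hρ hK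
  exact ⟨pb.basis.reindex (finCongr hdim), fun i => by simp [hgen]⟩

theorem elem_injective [NumberField K] {a : ℤ} (ha : 3 ≤ a) {ρ : K}
    (hρ : ρ ^ 3 + ((a : K) - 1) * ρ ^ 2 - a * ρ - 1 = 0)
    (hK : IntermediateField.adjoin ℚ {ρ} = ⊤) {x y z x' y' z' : ℤ}
    (h : elem ρ x y z = elem ρ x' y' z') : x = x' ∧ y = y' ∧ z = z' := by
  obtain ⟨b, hb⟩ := exists_basis ha hρ hK
  have key := Fintype.linearIndependent_iff.1 b.linearIndependent
    ![(x - x' : ℚ), y - y', z - z'] (by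
      simp only [elem] at h
      simp only [Fin.sum_univ_three, hb, Algebra.smul_def]
      simp
      linear_combination h)
  have h0 := key 0
  have h1 := key 1
  have h2 := key 2
  simp only [Matrix.cons_val_zero, Matrix.cons_val_one, Matrix.cons_val, sub_eq_zero,
    Int.cast_inj] at h0 h1 h2
  exact ⟨h0, h1, h2⟩

/-- The norm form of `ℤ[ρ]`: the columns of the matrix are the coordinates of `α`, `α ρ` and
`α ρ²` for `α = x + y ρ + z ρ²`. -/
theorem norm_elem [NumberField K] {a : ℤ} (ha : 3 ≤ a) {ρ : K}
    (hρ : ρ ^ 3 + ((a : K) - 1) * ρ ^ 2 - a * ρ - 1 = 0)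
    (hK : IntermediateField.adjoin ℚ {ρ} = ⊤) (x y z : ℤ) :
    Algebra.norm ℚ (elem ρ x y z) = Matrix.det
      !![(x : ℚ), z, y - (a - 1) * z;
        y, x + a * z, z + a * (y - (a - 1) * z);
        z, y - (a - 1) * z, x + a * z - (a - 1) * (y - (a - 1) * z)] := by
  obtain ⟨b, hb⟩ := exists_basis ha hρ hK
  rw [Algebra.norm_apply, ← LinearMap.det_toLin b]
  congr 1
  refine b.ext fun j => ?_
  rw [Matrix.toLin_self, Fin.sum_univ_three]
  simp only [hb, elem, Algebra.smul_def, Algebra.coe_lmul_eq_mul, LinearMap.mul_apply']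
  fin_cases j
  · simp
  · simp
    linear_combination (z : K) * hρ
  · simp
    linear_combination ((y : K) + z * ρ - z * ((a : K) - 1)) * hρ

theorem exists_embedding [NumberField K] {a : ℤ} (ha : 3 ≤ a) {ρ : K}
    (hρ : ρ ^ 3 + ((a : K) - 1) * ρ ^ 2 - a * ρ - 1 = 0)
    (hK : IntermediateField.adjoin ℚ {ρ} = ⊤) {r : ℝ}
    (hr : r ^ 3 + ((a : ℝ) - 1) * r ^ 2 - a * r - 1 = 0) : ∃ σ : K →+* ℝ, σ ρ = r := by
  obtain ⟨pb, hgen, -⟩ := exists_powerBasis ha hρ hK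
  have h : aeval r (minpoly ℚ pb.gen) = 0 := by
    rw [hgen, minpoly_eq ha hρ]
    simpa using hr
  refine ⟨(pb.lift r h).toRingHom, ?_⟩
  have := pb.lift_gen r h
  rwa [hgen] at this

/-- The three real roots of the cubic, isolated by sign changes. -/
theorem exists_real_roots {a : ℝ} (ha : 3 ≤ a) :
    ∃ r₁ r₂ r₃ : ℝ, (1 < r₁ ∧ r₁ < 2) ∧ (-1 / 2 < r₂ ∧ r₂ < 0) ∧ (-a < r₃ ∧ r₃ < 1 - a) ∧
      r₁ ^ 3 + (a - 1) * r₁ ^ 2 - a * r₁ - 1 = 0 ∧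
      r₂ ^ 3 + (a - 1) * r₂ ^ 2 - a * r₂ - 1 = 0 ∧
      r₃ ^ 3 + (a - 1) * r₃ ^ 2 - a * r₃ - 1 = 0 := by
  have hc : ∀ s : Set ℝ, ContinuousOn (fun r : ℝ => r ^ 3 + (a - 1) * r ^ 2 - a * r - 1) s :=
    fun s => by fun_prop
  obtain ⟨r₁, h₁, e₁⟩ := intermediate_value_Ioo (by norm_num : (1 : ℝ) ≤ 2) (hc _)
    (show (0 : ℝ) ∈ Set.Ioo _ _ from ⟨by linarith, by linarith⟩)
  obtain ⟨r₂, h₂, e₂⟩ := intermediate_value_Ioo' (by norm_num : (-1 / 2 : ℝ) ≤ 0) (hc _)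
    (show (0 : ℝ) ∈ Set.Ioo _ _ from ⟨by norm_num, by linarith⟩)
  obtain ⟨r₃, h₃, e₃⟩ := intermediate_value_Ioo (by linarith : -a ≤ 1 - a) (hc _)
    (show (0 : ℝ) ∈ Set.Ioo _ _ from ⟨by ring_nf; norm_num, by nlinarith⟩)
  exact ⟨r₁, r₂, r₃, h₁, h₂, h₃, e₁, e₂, e₃⟩

/-! ### Two positive functionals -/

/-- Both functionals `x + y ρ + z ρ² ↦ a (x + z)` and `x + y ρ + z ρ² ↦ a (x + z) - y` are positive
combinations of the three real embeddings, by Lagrange interpolation at the roots. -/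
theorem functionals_pos [NumberField K] {a : ℤ} (ha : 3 ≤ a) {ρ : K}
    (hρ : ρ ^ 3 + ((a : K) - 1) * ρ ^ 2 - a * ρ - 1 = 0)
    (hK : IntermediateField.adjoin ℚ {ρ} = ⊤) {x y z : ℤ}
    (h : IsTotallyPositive (elem ρ x y z)) : 0 < a * (x + z) ∧ 0 < a * (x + z) - y := by
  have ha' : (3 : ℝ) ≤ a := by exact_mod_cast ha
  obtain ⟨r₁, r₂, r₃, ⟨h₁, h₁'⟩, ⟨h₂, h₂'⟩, ⟨h₃, h₃'⟩, e₁, e₂, e₃⟩ := exists_real_roots ha'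
  have hpos : ∀ r : ℝ, r ^ 3 + ((a : ℝ) - 1) * r ^ 2 - a * r - 1 = 0 →
      0 < x + y * r + z * r ^ 2 := fun r hr => by
    obtain ⟨σ, rfl⟩ := exists_embedding ha hρ hK hr
    rw [← map_elem]
    exact h σ
  have q₁ := hpos r₁ e₁
  have q₂ := hpos r₂ e₂
  have q₃ := hpos r₃ e₃
  have d₁ : 0 < r₂ - r₃ := by linarith
  have d₂ : 0 < r₁ - r₃ := by linarith
  have d₃ : 0 < r₁ - r₂ := by linarith
  have w₁ : 0 < 1 + r₂ * r₃ := by nlinarith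
  have w₂ : 0 < -(1 + r₁ * r₃) := by nlinarith
  have w₃ : 0 < 1 + r₁ * r₂ := by nlinarith
  have v₁ : 0 < a * (1 + r₂ * r₃) + (r₂ + r₃) := by
    nlinarith [mul_pos (neg_pos.2 h₂') (show 0 < -(a * r₃ + 1) by nlinarith)]
  have v₂ : 0 < -(a * (1 + r₁ * r₃) + (r₁ + r₃)) := by
    nlinarith [mul_pos (sub_pos.2 h₁) (show 0 < -(a * r₃ + 1) by nlinarith)]
  have v₃ : 0 < a * (1 + r₁ * r₂) + (r₁ + r₂) := by
    have := mul_pos (by linarith : (0 : ℝ) < a) w₃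
    linarith
  have hD : 0 < (r₂ - r₃) * (r₁ - r₃) * (r₁ - r₂) := by positivity
  have hL : (0 : ℝ) < x + z := by
    refine pos_of_mul_pos_right (b := (x + z : ℝ)) ?_ hD.le
    have i₁ := mul_pos (mul_pos d₁ w₁) q₁
    have i₂ := mul_pos (mul_pos d₂ w₂) q₂
    have i₃ := mul_pos (mul_pos d₃ w₃) q₃
    linarith
  have hM : (0 : ℝ) < a * (x + z) - y := by
    refine pos_of_mul_pos_right (b := (a * (x + z) - y : ℝ)) ?_ hD.le
    have i₁ := mul_pos (mul_pos d₁ v₁) q₁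
    have i₂ := mul_pos (mul_pos d₂ v₂) q₂
    have i₃ := mul_pos (mul_pos d₃ v₃) q₃
    linarith
  have hL' : 0 < x + z := by exact_mod_cast hL
  exact ⟨by positivity, by exact_mod_cast hM⟩

/-! ### Totally positive units and cones -/

theorem _root_.IsTotallyPositive.mul {α β : K} (hα : IsTotallyPositive α) (hβ : IsTotallyPositive β) :
    IsTotallyPositive (α * β) := fun σ => by
  rw [map_mul]; exact mul_pos (hα σ) (hβ σ)

theorem _root_.IsTotallyPositive.inv {α : K} (hα : IsTotallyPositive α) :
    IsTotallyPositive α⁻¹ := fun σ => by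
  rw [map_inv₀]; exact inv_pos.2 (hα σ)

/-- A totally positive unit of `ℤ[ρ]`; that its norm is `1` is recorded as part of the notion. -/
structure IsPosUnit [NumberField K] (ρ u : K) : Prop where
  mem : u ∈ Algebra.adjoin ℤ {ρ}
  inv_mem : u⁻¹ ∈ Algebra.adjoin ℤ {ρ}
  pos : IsTotallyPositive u
  norm : Algebra.norm ℚ u = 1

theorem IsPosUnit.one [NumberField K] (ρ : K) : IsPosUnit ρ 1 :=
  ⟨one_mem _, by simp, fun σ => by simp, by simp⟩

theorem IsPosUnit.mul [NumberField K] {ρ u v : K} (hu : IsPosUnit ρ u) (hv : IsPosUnit ρ v) :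
    IsPosUnit ρ (u * v) :=
  ⟨mul_mem hu.mem hv.mem, by rw [mul_inv]; exact mul_mem hu.inv_mem hv.inv_mem,
    hu.pos.mul hv.pos, by rw [map_mul, hu.norm, hv.norm, mul_one]⟩

theorem IsPosUnit.ne_zero [NumberField K] {ρ u : K} (hu : IsPosUnit ρ u) : u ≠ 0 := by
  rintro rfl
  simpa using hu.norm

theorem IsPosUnit.inv [NumberField K] {ρ u : K} (hu : IsPosUnit ρ u) : IsPosUnit ρ u⁻¹ := by
  refine ⟨hu.inv_mem, by rw [inv_inv]; exact hu.mem, hu.pos.inv, ?_⟩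
  have h : Algebra.norm ℚ (u * u⁻¹) = 1 := by rw [mul_inv_cancel₀ hu.ne_zero, map_one]
  rwa [map_mul, hu.norm, one_mul] at h

/-- Positivity of `r + a` and of `r (r - 1)`, whose product is `1`, at every real root `r`. -/
theorem root_pos {a r : ℝ} (hr : r ^ 3 + (a - 1) * r ^ 2 - a * r - 1 = 0) (ha : 3 ≤ a) :
    0 < r + a ∧ 0 < r ^ 2 - r ∧ 0 < r ^ 2 := by
  have h : (r ^ 2 - r) * (r + a) = 1 := by linear_combination hr
  have h1 : 0 < r + a := by
    by_contra! hle
    have : 0 ≤ r ^ 2 - r := by nlinarith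
    nlinarith
  have h2 : 0 < r ^ 2 - r := pos_of_mul_pos_left (by rw [h]; exact one_pos) h1.le
  refine ⟨h1, h2, ?_⟩
  rcases eq_or_ne r 0 with rfl | h0
  · simp at h2
  · positivity

theorem root_map {a : ℤ} {ρ : K}
    (hρ : ρ ^ 3 + ((a : K) - 1) * ρ ^ 2 - a * ρ - 1 = 0) (σ : K →+* ℝ) :
    σ ρ ^ 3 + ((a : ℝ) - 1) * σ ρ ^ 2 - a * σ ρ - 1 = 0 := by
  have := congrArg σ hρ
  simpa using this

theorem isPosUnit_elem [NumberField K] {a : ℤ} (ha : 3 ≤ a) {ρ : K}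
    (hρ : ρ ^ 3 + ((a : K) - 1) * ρ ^ 2 - a * ρ - 1 = 0)
    (hK : IntermediateField.adjoin ℚ {ρ} = ⊤) :
    IsPosUnit ρ (elem ρ a 1 0) ∧ IsPosUnit ρ (elem ρ 1 a 1) ∧
      IsPosUnit ρ (elem ρ 0 (-1) 1) ∧ IsPosUnit ρ (elem ρ (a + 1) (1 - a) (-1)) := by
  have ha' : (3 : ℝ) ≤ a := by exact_mod_cast ha
  have i₁ : (elem ρ a 1 0)⁻¹ = elem ρ 0 (-1) 1 := by
    refine inv_eq_of_mul_eq_one_right ?_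
    simp only [elem]; push_cast; linear_combination hρ
  have i₂ : (elem ρ 1 a 1)⁻¹ = elem ρ (a + 1) (1 - a) (-1) := by
    refine inv_eq_of_mul_eq_one_right ?_
    simp only [elem]; push_cast; linear_combination (-ρ - a) * hρ
  have u₁ : IsPosUnit ρ (elem ρ a 1 0) := by
    refine ⟨elem_mem _ _ _ _, i₁ ▸ elem_mem _ _ _ _, fun σ => ?_, ?_⟩
    · rw [map_elem]
      have := (root_pos (root_map hρ σ) ha').1
      push_cast; linarith
    · rw [norm_elem ha hρ hK, Matrix.det_fin_three]
      simp
  have u₂ : IsPosUnit ρ (elem ρ 1 a 1) := by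
    refine ⟨elem_mem _ _ _ _, i₂ ▸ elem_mem _ _ _ _, fun σ => ?_, ?_⟩
    · rw [map_elem]
      have hr := root_map hρ σ
      obtain ⟨h₁, -, h₂⟩ := root_pos hr ha'
      have := mul_pos h₂ h₁
      push_cast; linarith
    · rw [norm_elem ha hρ hK, Matrix.det_fin_three]
      simp
      ring
  exact ⟨u₁, u₂, i₁ ▸ u₁.inv, i₂ ▸ u₂.inv⟩

/-- Membership of `x + y ρ + z ρ²` in the closed cone spanned by the units `1`, `ρ²` and
`ρ² - ρ`, which form a basis of `ℤ[ρ]`. -/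
def InUnimodularCone (x y z : ℤ) : Prop := 0 ≤ x ∧ y ≤ 0 ∧ 0 ≤ y + z

/-- Membership of `x + y ρ + z ρ²` in the closed cone spanned by the units `1`, `ρ²` and
`ρ² + a ρ + 1 = ρ² (ρ + a)`, which generate a subgroup of index `a` of `ℤ[ρ]`. -/
def InLargeCone (a x y z : ℤ) : Prop := 0 ≤ y ∧ y ≤ a * x ∧ y ≤ a * z

theorem InUnimodularCone.isTotallyPositive {a : ℤ} (ha : 3 ≤ a) {ρ : K}
    (hρ : ρ ^ 3 + ((a : K) - 1) * ρ ^ 2 - a * ρ - 1 = 0) {x y z : ℤ}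
    (h : InUnimodularCone x y z) (h0 : 0 < x + z) : IsTotallyPositive (elem ρ x y z) := by
  intro σ
  have ha' : (3 : ℝ) ≤ a := by exact_mod_cast ha
  obtain ⟨-, h₁, h₂⟩ := root_pos (root_map hρ σ) ha'
  obtain ⟨hx, hy, hz⟩ := h
  have hx' : (0 : ℝ) ≤ x := by exact_mod_cast hx
  have hy' : (0 : ℝ) ≤ -y := by exact_mod_cast neg_nonneg.2 hy
  have hz' : (0 : ℝ) ≤ y + z := by exact_mod_cast hz
  have h0' : (0 : ℝ) < x + z := by exact_mod_cast h0
  rw [map_elem]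
  have e : (x : ℝ) + y * σ ρ + z * σ ρ ^ 2 =
      x + (y + z) * σ ρ ^ 2 + (-y) * (σ ρ ^ 2 - σ ρ) := by ring
  rw [e]
  rcases hx'.lt_or_eq with hx' | hx'
  · positivity
  rcases hz'.lt_or_eq with hz' | hz'
  · positivity
  have : (0 : ℝ) < -y := by linarith
  positivity

theorem InLargeCone.isTotallyPositive {a : ℤ} (ha : 3 ≤ a) {ρ : K}
    (hρ : ρ ^ 3 + ((a : K) - 1) * ρ ^ 2 - a * ρ - 1 = 0) {x y z : ℤ}
    (h : InLargeCone a x y z) (h0 : 0 < x + z) : IsTotallyPositive (elem ρ x y z) := by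
  intro σ
  have ha' : (3 : ℝ) ≤ a := by exact_mod_cast ha
  have hr := root_map hρ σ
  obtain ⟨h₁, -, h₂⟩ := root_pos hr ha'
  obtain ⟨hy, hx, hz⟩ := h
  have hx' : (0 : ℝ) ≤ a * x - y := by exact_mod_cast sub_nonneg.2 hx
  have hy' : (0 : ℝ) ≤ y := by exact_mod_cast hy
  have hz' : (0 : ℝ) ≤ a * z - y := by exact_mod_cast sub_nonneg.2 hz
  have h0' : (0 : ℝ) < x + z := by exact_mod_cast h0
  rw [map_elem]
  have e : (a : ℝ) * (x + y * σ ρ + z * σ ρ ^ 2) =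
      (a * x - y) + (a * z - y) * σ ρ ^ 2 + y * (σ ρ ^ 2 * (σ ρ + a)) := by
    linear_combination (-(y : ℝ)) * hr
  refine pos_of_mul_pos_right (b := (x + y * σ ρ + z * σ ρ ^ 2 : ℝ)) ?_
    (by linarith : (0 : ℝ) ≤ a)
  rw [e]
  rcases hx'.lt_or_eq with hx' | hx'
  · positivity
  rcases hz'.lt_or_eq with hz' | hz'
  · positivity
  have : (0 : ℝ) < y := by nlinarith
  positivity

/-! ### Descent to the cones -/

/-- A totally positive element at which one of the functionals takes the value `n` has a unit
multiple in one of the two cones, at which the functional that is constant on the generators of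
that cone is at most `n`. Outside the cones, a neighbouring cone gives a smaller value. -/
theorem exists_unit_mul_mem_cone [NumberField K] {a : ℤ} (ha : 3 ≤ a) {ρ : K}
    (hρ : ρ ^ 3 + ((a : K) - 1) * ρ ^ 2 - a * ρ - 1 = 0)
    (hK : IntermediateField.adjoin ℚ {ρ} = ⊤) (n : ℕ) : ∀ x y z : ℤ,
    IsTotallyPositive (elem ρ x y z) → (a * (x + z) = n ∨ a * (x + z) - y = n) →
    ∃ u x' y' z', IsPosUnit ρ u ∧ u * elem ρ x y z = elem ρ x' y' z' ∧
      ((InUnimodularCone x' y' z' ∧ a * (x' + z') ≤ n) ∨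
        (InLargeCone a x' y' z' ∧ a * (x' + z') - y' ≤ n)) := by
  obtain ⟨u₁, u₂, u₃, u₄⟩ := isPosUnit_elem ha hρ hK
  induction n using Nat.strong_induction_on with
  | _ n ih =>
  intro x y z h hn
  have step : ∀ {p q r x₁ y₁ z₁ : ℤ}, IsPosUnit ρ (elem ρ p q r) →
      elem ρ p q r * elem ρ x y z = elem ρ x₁ y₁ z₁ →
      (a * (x₁ + z₁) < n ∨ a * (x₁ + z₁) - y₁ < n) →
      ∃ u x' y' z', IsPosUnit ρ u ∧ u * elem ρ x y z = elem ρ x' y' z' ∧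
        ((InUnimodularCone x' y' z' ∧ a * (x' + z') ≤ n) ∨
          (InLargeCone a x' y' z' ∧ a * (x' + z') - y' ≤ n)) := by
    intro p q r x₁ y₁ z₁ hu he hlt
    have h₁ : IsTotallyPositive (elem ρ x₁ y₁ z₁) := he ▸ hu.pos.mul h
    obtain ⟨l₁, l₂⟩ := functionals_pos ha hρ hK h₁
    have : ∃ m : ℕ, m < n ∧ (a * (x₁ + z₁) = m ∨ a * (x₁ + z₁) - y₁ = m) := by
      rcases hlt with hlt | hlt
      · exact ⟨(a * (x₁ + z₁)).toNat, by omega, by omega⟩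
      · exact ⟨(a * (x₁ + z₁) - y₁).toNat, by omega, by omega⟩
    obtain ⟨m, hm, hm'⟩ := this
    obtain ⟨u, x', y', z', hu', he', hc⟩ := ih m hm x₁ y₁ z₁ h₁ hm'
    refine ⟨u * elem ρ p q r, x', y', z', hu'.mul hu, by rw [mul_assoc, he, he'], ?_⟩
    rcases hc with ⟨c, l⟩ | ⟨c, l⟩
    · exact Or.inl ⟨c, by omega⟩
    · exact Or.inr ⟨c, by omega⟩
  have stay : IsPosUnit ρ (elem ρ 1 0 0) := by
    simpa [elem] using IsPosUnit.one ρ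
  have hstay : elem ρ 1 0 0 * elem ρ x y z = elem ρ x y z := by simp [elem]
  have hc : 0 < a * (a - 1) - 1 := by nlinarith
  rcases hn with hn | hn
  · by_cases hy : 0 < y
    · exact step stay hstay (Or.inr (by omega))
    by_cases hx : x < 0
    · exact step u₁ (elem_mul hρ _ _ _ _ _ _) (Or.inr (by
        linarith [mul_pos (neg_pos.2 hx) hc]))
    by_cases hz : y + z < 0
    · exact step u₂ (elem_mul hρ _ _ _ _ _ _) (Or.inr (by nlinarith))
    exact ⟨1, x, y, z, IsPosUnit.one ρ, one_mul _,
      Or.inl ⟨⟨by omega, by omega, by omega⟩, hn.le⟩⟩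
  · by_cases hy : y < 0
    · exact step stay hstay (Or.inl (by omega))
    by_cases hz : a * z < y
    · refine step u₃ (elem_mul hρ _ _ _ _ _ _) (Or.inl ?_)
      linarith [mul_pos (sub_pos.2 hz) hc]
    by_cases hx : a * x < y
    · refine step u₄ (elem_mul hρ _ _ _ _ _ _) (Or.inl ?_)
      linarith [mul_pos (sub_pos.2 hx) (show 0 < a - 1 by omega)]
    exact ⟨1, x, y, z, IsPosUnit.one ρ, one_mul _,
      Or.inr ⟨⟨by omega, by omega, by omega⟩, hn.le⟩⟩

theorem le_mul_of_pos {a x z : ℤ} (ha : 3 ≤ a)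
    (h0 : 0 < a * (x + z)) : a ≤ a * (x + z) := by
  have : 0 < x + z := pos_of_mul_pos_right h0 (by omega)
  nlinarith

theorem le_of_inLargeCone {a x y z : ℤ} (ha : 3 ≤ a) (h : InLargeCone a x y z)
    (h0 : 0 < a * (x + z)) : a ≤ a * (x + z) - y := by
  obtain ⟨hy, hx, hz⟩ := h
  have h1 : 0 < x + z := pos_of_mul_pos_right h0 (by omega)
  rcases le_or_gt z 0 with hz0 | hz0
  · have : y ≤ 0 := hz.trans (by nlinarith)
    nlinarith
  · nlinarith

/-- The convex hull of the totally positive units contains every totally positive element of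
`ℤ[ρ]`; only the facet with vertices `1`, `ρ²`, `ρ² + a ρ + 1` is recorded. -/
theorem le_functional [NumberField K] {a : ℤ} (ha : 3 ≤ a) {ρ : K}
    (hρ : ρ ^ 3 + ((a : K) - 1) * ρ ^ 2 - a * ρ - 1 = 0)
    (hK : IntermediateField.adjoin ℚ {ρ} = ⊤) {x y z : ℤ}
    (h : IsTotallyPositive (elem ρ x y z)) : a ≤ a * (x + z) - y := by
  obtain ⟨-, l⟩ := functionals_pos ha hρ hK h
  obtain ⟨n, hn⟩ := Int.eq_ofNat_of_zero_le l.le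
  obtain ⟨u, x', y', z', hu, he, hc⟩ :=
    exists_unit_mul_mem_cone ha hρ hK n x y z h (Or.inr hn)
  have l' := (functionals_pos ha hρ hK (he ▸ hu.pos.mul h)).1
  rw [hn]
  rcases hc with ⟨-, hle⟩ | ⟨c, hle⟩
  · exact (le_mul_of_pos ha l').trans hle
  · exact (le_of_inLargeCone ha c l').trans hle

/-! ### Indecomposable elements -/

theorem _root_.IsIndecomposableIn.unit_mul [NumberField K] {ρ u α : K}
    (h : IsIndecomposableIn (Algebra.adjoin ℤ {ρ}) α) (hu : IsPosUnit ρ u) :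
    IsIndecomposableIn (Algebra.adjoin ℤ {ρ}) (u * α) := by
  refine ⟨⟨mul_mem hu.mem h.1.1, hu.pos.mul h.1.2⟩, ?_⟩
  rintro ⟨β, γ, hβ, hγ, e⟩
  refine h.2 ⟨u⁻¹ * β, u⁻¹ * γ, ⟨mul_mem hu.inv_mem hβ.1, hu.pos.inv.mul hβ.2⟩,
    ⟨mul_mem hu.inv_mem hγ.1, hu.pos.inv.mul hγ.2⟩, ?_⟩
  rw [← mul_add, ← e, inv_mul_cancel_left₀ hu.ne_zero]

theorem not_indecomposable_elem {ρ : K} {x y z p q r : ℤ}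
    (h₁ : IsTotallyPositive (elem ρ p q r))
    (h₂ : IsTotallyPositive (elem ρ (x - p) (y - q) (z - r))) :
    ¬ IsIndecomposableIn (Algebra.adjoin ℤ {ρ}) (elem ρ x y z) := fun h =>
  h.2 ⟨_, _, ⟨elem_mem ρ p q r, h₁⟩, ⟨elem_mem _ _ _ _, h₂⟩, by rw [elem_add]; congr 1 <;> ring⟩

theorem indecomposable_of_inUnimodularCone {a : ℤ} (ha : 3 ≤ a) {ρ : K}
    (hρ : ρ ^ 3 + ((a : K) - 1) * ρ ^ 2 - a * ρ - 1 = 0) {x y z : ℤ}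
    (hc : InUnimodularCone x y z) (h0 : 0 < x + z)
    (h : IsIndecomposableIn (Algebra.adjoin ℤ {ρ}) (elem ρ x y z)) :
    (x = 1 ∧ y = 0 ∧ z = 0) ∨ (x = 0 ∧ y = 0 ∧ z = 1) ∨ (x = 0 ∧ y = -1 ∧ z = 1) := by
  have tp : ∀ p q r : ℤ, InUnimodularCone p q r → 0 < p + r →
      IsTotallyPositive (elem ρ p q r) := fun p q r h h' => h.isTotallyPositive ha hρ h'
  by_contra hne
  have key : ∀ p q r : ℤ, InUnimodularCone p q r → 0 < p + r →
      ¬ (InUnimodularCone (x - p) (y - q) (z - r) ∧ 0 < x - p + (z - r)) :=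
    fun p q r h₁ h₂ h₃ => not_indecomposable_elem (tp p q r h₁ h₂) (tp _ _ _ h₃.1 h₃.2) h
  have k₁ := key 1 0 0
  have k₂ := key 0 0 1
  have k₃ := key 0 (-1) 1
  simp only [InUnimodularCone] at *
  omega

theorem indecomposable_of_inLargeCone {a : ℤ} (ha : 3 ≤ a) {ρ : K}
    (hρ : ρ ^ 3 + ((a : K) - 1) * ρ ^ 2 - a * ρ - 1 = 0) {x y z : ℤ}
    (hc : InLargeCone a x y z) (h0 : 0 < x + z)
    (h : IsIndecomposableIn (Algebra.adjoin ℤ {ρ}) (elem ρ x y z)) :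
    (x = 1 ∧ y = 0 ∧ z = 0) ∨ (x = 0 ∧ y = 0 ∧ z = 1) ∨ (x = 1 ∧ y = a ∧ z = 1) ∨
      (x = 1 ∧ 0 < y ∧ y < a ∧ z = 1) := by
  have key : ∀ p q r : ℤ, InLargeCone a p q r → 0 < p + r →
      ¬ (InLargeCone a (x - p) (y - q) (z - r) ∧ 0 < x - p + (z - r)) :=
    fun p q r h₁ h₂ h₃ => not_indecomposable_elem (h₁.isTotallyPositive ha hρ h₂)
      (h₃.1.isTotallyPositive ha hρ h₃.2) h
  have k₁ := key 1 0 0 ⟨le_rfl, by omega, by omega⟩ (by omega)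
  have k₂ := key 0 0 1 ⟨le_rfl, by omega, by omega⟩ (by omega)
  have k₃ := key 1 a 1 ⟨by omega, by omega, by omega⟩ (by omega)
  obtain ⟨hy, hx, hz⟩ := hc
  have hx0 : 0 ≤ x := by nlinarith
  have hz0 : 0 ≤ z := by nlinarith
  simp only [InLargeCone, mul_sub, mul_one, sub_zero] at k₁ k₂ k₃
  rcases hy.lt_or_eq with hy | rfl
  · have hx1 : 0 < x := by nlinarith
    have hz1 : 0 < z := by nlinarith
    rcases lt_or_ge y a with hya | hya
    · have hx2 : x < 2 := by
        by_contra! hx2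
        exact k₁ ⟨⟨by omega, by nlinarith, by omega⟩, by omega⟩
      have hz2 : z < 2 := by
        by_contra! hz2
        exact k₂ ⟨⟨by omega, by omega, by nlinarith⟩, by omega⟩
      omega
    · have : ¬ 0 < x - 1 + (z - 1) := fun hp => k₃ ⟨⟨by omega, by omega, by omega⟩, hp⟩
      have hx2 : x = 1 := by omega
      have hz2 : z = 1 := by omega
      subst hx2 hz2
      omega
  · rcases hx0.lt_or_eq with hx1 | rfl
    · have : ¬ 0 < x - 1 + z := fun hp => k₁ ⟨⟨le_rfl, by nlinarith, by omega⟩, hp⟩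
      omega
    · have : ¬ 0 < z - 1 := fun hp => k₂ ⟨⟨le_rfl, by omega, by nlinarith⟩, by omega⟩
      omega

theorem norm_interior [NumberField K] {a : ℤ} (ha : 3 ≤ a) {ρ : K}
    (hρ : ρ ^ 3 + ((a : K) - 1) * ρ ^ 2 - a * ρ - 1 = 0)
    (hK : IntermediateField.adjoin ℚ {ρ} = ⊤) (m : ℤ) :
    Algebra.norm ℚ (elem ρ 1 (a - m) 1) = (a + 2 - m) * m * (m + 1) + 1 := by
  rw [norm_elem ha hρ hK, Matrix.det_fin_three]
  simp
  ring

/-- The indecomposables up to totally positive units: `1` and the elements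
`1 + (a - m) ρ + ρ²` with `0 < m < a`. -/
theorem norm_of_indecomposable [NumberField K] {a : ℤ} (ha : 3 ≤ a) {ρ : K}
    (hρ : ρ ^ 3 + ((a : K) - 1) * ρ ^ 2 - a * ρ - 1 = 0)
    (hK : IntermediateField.adjoin ℚ {ρ} = ⊤) {α : K}
    (h : IsIndecomposableIn (Algebra.adjoin ℤ {ρ}) α) :
    Algebra.norm ℚ α = 1 ∨
      ∃ m : ℤ, 0 < m ∧ m < a ∧ Algebra.norm ℚ α = (a + 2 - m) * m * (m + 1) + 1 := by
  obtain ⟨x, y, z, rfl⟩ := exists_elem_of_mem hρ h.1.1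
  obtain ⟨l, -⟩ := functionals_pos ha hρ hK h.1.2
  obtain ⟨n, hn⟩ := Int.eq_ofNat_of_zero_le l.le
  obtain ⟨u, x', y', z', hu, he, hc⟩ :=
    exists_unit_mul_mem_cone ha hρ hK n x y z h.1.2 (Or.inl hn)
  have hN : Algebra.norm ℚ (elem ρ x y z) = Algebra.norm ℚ (elem ρ x' y' z') := by
    rw [← he, map_mul, hu.norm, one_mul]
  have h' := h.unit_mul hu
  rw [he] at h'
  have h0 : 0 < x' + z' :=
    pos_of_mul_pos_right (functionals_pos ha hρ hK h'.1.2).1 (by omega)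
  rw [hN]
  rcases hc with ⟨c, -⟩ | ⟨c, -⟩
  · left
    rcases indecomposable_of_inUnimodularCone ha hρ c h0 h' with
      ⟨rfl, rfl, rfl⟩ | ⟨rfl, rfl, rfl⟩ | ⟨rfl, rfl, rfl⟩ <;>
    · rw [norm_elem ha hρ hK, Matrix.det_fin_three]
      simp
      try ring
  · rcases indecomposable_of_inLargeCone ha hρ c h0 h' with
      ⟨rfl, rfl, rfl⟩ | ⟨rfl, rfl, rfl⟩ | ⟨rfl, rfl, rfl⟩ | ⟨rfl, hy, hya, rfl⟩
    · left; simp [elem]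
    · left
      rw [norm_elem ha hρ hK, Matrix.det_fin_three]
      simp
      try ring
    · left
      exact (isPosUnit_elem ha hρ hK).2.1.norm
    · right
      refine ⟨a - y', by omega, by omega, ?_⟩
      rw [← norm_interior ha hρ hK, sub_sub_cancel]

/-- The functional `a (x + z) - y` is at least `a` on each of two totally positive summands, but is
only `a + m < 2 a` on the sum. -/
theorem indecomposable_interior [NumberField K] {a : ℤ} (ha : 3 ≤ a) {ρ : K}
    (hρ : ρ ^ 3 + ((a : K) - 1) * ρ ^ 2 - a * ρ - 1 = 0)
    (hK : IntermediateField.adjoin ℚ {ρ} = ⊤) {m : ℤ} (hm : 0 < m) (hma : m < a) :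
    IsIndecomposableIn (Algebra.adjoin ℤ {ρ}) (elem ρ 1 (a - m) 1) := by
  have hc : InLargeCone a 1 (a - m) 1 := ⟨by omega, by omega, by omega⟩
  refine ⟨⟨elem_mem _ _ _ _, hc.isTotallyPositive ha hρ (by omega)⟩, ?_⟩
  rintro ⟨β, γ, ⟨hβ, hβ'⟩, ⟨hγ, hγ'⟩, e⟩
  obtain ⟨x, y, z, rfl⟩ := exists_elem_of_mem hρ hβ
  obtain ⟨x', y', z', rfl⟩ := exists_elem_of_mem hρ hγ
  rw [elem_add] at e
  obtain ⟨e₁, e₂, e₃⟩ := elem_injective ha hρ hK e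
  have l := le_functional ha hρ hK hβ'
  have l' := le_functional ha hρ hK hγ'
  have : a * (x + z) + a * (x' + z') = 2 * a := by
    linear_combination (-a) * e₁ - a * e₃
  omega

/-! ### Maximising the norm -/

/-- With `g(m) = (a + 2 - m) m (m + 1)` one has `g(M) - g(M - 1) = M (2 a + 5 - 3 M)`, so the
hypotheses say that `g` increases up to `M` and, unless `M = a - 1` ends the range, not beyond. -/
theorem norm_form_le {a m M : ℤ} (hm : 0 < m) (hma : m < a) (hM : 0 < M) (hMa : M < a)
    (h₁ : 3 * M ≤ 2 * a + 5) (h₂ : M + 1 = a ∨ 2 * a + 2 ≤ 3 * M) :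
    (a + 2 - m) * m * (m + 1) + 1 ≤ (a + 2 - M) * M * (M + 1) + 1 := by
  -- `q` is the difference quotient of `g`, as a function of `m`.
  obtain ⟨q, hq⟩ : ∃ q, q = -(M ^ 2 + M * m + m ^ 2) + (a + 1) * (M + m) + (a + 2) := ⟨_, rfl⟩
  have hdiff : (a + 2 - M) * M * (M + 1) - (a + 2 - m) * m * (m + 1) = (M - m) * q := by
    rw [hq]; ring
  rcases lt_trichotomy m M with h | rfl | h
  · -- `q` is concave in `m` and nonnegative at the end points `0` and `M - 1`.
    have i₁ : 0 ≤ m * (M * (2 * a + 5 - 3 * M)) := by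
      have : 0 ≤ 2 * a + 5 - 3 * M := by omega
      positivity
    have i₂ : 0 ≤ (M - 1 - m) * (M * (a - M) + M + (a + 2)) := by
      have : 0 ≤ M - 1 - m := by omega
      have : 0 < a - M := by omega
      have : 0 < a := by omega
      positivity
    have i₃ : 0 ≤ m * (M - 1 - m) * (M - 1) := by
      have : 0 ≤ M - 1 - m := by omega
      have : 0 ≤ M - 1 := by omega
      positivity
    have i : 0 ≤ (M - 1) * q := by
      rw [hq]; linarith
    have hq0 : 0 ≤ q := nonneg_of_mul_nonneg_right i (by omega)
    linarith [mul_nonneg (show 0 ≤ M - m by omega) hq0]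
  · exact le_rfl
  · have h₃ : 2 * a + 2 ≤ 3 * M := h₂.resolve_left (by omega)
    have i₁ : 0 ≤ (M + 1) * (3 * M - 2 * a - 2) :=
      mul_nonneg (by omega) (by omega)
    have i₂ : 0 ≤ (m - M - 1) * (2 * M + m - a) := mul_nonneg (by omega) (by omega)
    have hq0 : 0 ≤ -q := by
      rw [hq]; linarith
    linarith [mul_nonneg (show 0 ≤ m - M by omega) hq0]

theorem exists_maximiser {a A a₀ : ℕ} (ha : 3 ≤ a) (ha₀ : a₀ = 0 ∨ a₀ = 1 ∨ a₀ = 2)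
    (haA : a = 3 * A + a₀) :
    ∃ M : ℤ, (0 < M ∧ M < a) ∧ (3 * M ≤ 2 * a + 5 ∧ (M + 1 = a ∨ 2 * (a : ℤ) + 2 ≤ 3 * M)) ∧
      ennolaNormBound a A a₀ = ((a : ℤ) + 2 - M) * M * (M + 1) + 1 := by
  unfold ennolaNormBound
  split_ifs with h h₂ h₁
  · exact ⟨a - 1, by omega, by omega, by push_cast; ring⟩
  · subst h₂ haA
    exact ⟨2 * A + 2, by omega, by omega, by push_cast; ring⟩
  · subst h₁ haA
    exact ⟨2 * A + 2, by omega, by omega, by push_cast; ring⟩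
  · obtain rfl : a₀ = 0 := by omega
    subst haA
    exact ⟨2 * A + 1, by omega, by omega, by push_cast; ring⟩

end EnnolaCubic

theorem mainTheorem6 {K : Type*} [Field K] [NumberField K]
    (a A a₀ : ℕ) (ha : 3 ≤ a) (ha₀ : a₀ = 0 ∨ a₀ = 1 ∨ a₀ = 2) (haA : a = 3 * A + a₀)
    (ρ : K) (hρ : ρ ^ 3 + ((a : K) - 1) * ρ ^ 2 - (a : K) * ρ - 1 = 0)
    (hK : IntermediateField.adjoin ℚ {ρ} = ⊤) :
    (∀ α : K, IsIndecomposableIn (Algebra.adjoin ℤ {ρ}) α →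
      Algebra.norm ℚ α ≤ ennolaNormBound a A a₀) ∧
    (∃ α : K, IsIndecomposableIn (Algebra.adjoin ℤ {ρ}) α ∧
      Algebra.norm ℚ α = ennolaNormBound a A a₀) := by
  have hρ' : ρ ^ 3 + (((a : ℤ) : K) - 1) * ρ ^ 2 - ((a : ℤ) : K) * ρ - 1 = 0 := by
    simpa only [Int.cast_natCast] using hρ
  have ha' : (3 : ℤ) ≤ a := by exact_mod_cast ha
  obtain ⟨M, ⟨hM, hMa⟩, ⟨h₁, h₂⟩, hB⟩ := EnnolaCubic.exists_maximiser ha ha₀ haA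
  rw [hB]
  refine ⟨fun α hα => ?_, _, EnnolaCubic.indecomposable_interior ha' hρ' hK hM hMa,
    EnnolaCubic.norm_interior ha' hρ' hK M⟩
  rcases EnnolaCubic.norm_of_indecomposable ha' hρ' hK hα with h | ⟨m, hm, hma, h⟩
  · rw [h]
    have h3 : 0 ≤ ((a : ℤ) + 2 - M) * M * (M + 1) :=
      mul_nonneg (mul_nonneg (by omega) hM.le) (by omega)
    have : (0 : ℚ) ≤ (((a : ℤ) + 2 - M) * M * (M + 1) : ℚ) := by exact_mod_cast h3
    linarith
  · rw [h]
    exact_mod_cast EnnolaCubic.norm_form_le hm hma hM hMa h₁ h₂
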